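/- Let $Y$ and $Z$ be Banach spaces over $\mathbb K\in\{\mathbb R,\mathbb C\}$, and let $S(\cdot)$ denote the unit sphere. For closed subspaces $V,W$ of a Banach space $X$ put $$\Omega_0(V,W)=\sup\{\operatorname{dist}(v,S(W)) : v\in S(V)\},\qquad \Omega(V,W)=\max\{\Omega_0(V,W),\Omega_0(W,V)\}$$ (with $\operatorname{dist}(v,\emptyset)=\infty$ and $\sup\emptyset=0$, which matters only for zero spaces), and let $$d_\Omega(Y,Z)=\inf_{X,U,V}\Omega(UY,VZ),$$ where the infimum is over all Banach spaces $X$ and all linear isometric embeddings $U:Y\to X$ and $V:Z\to X$. Let $k(Y,Z)$ be the infimum of $$\sup\{|y^*(y)-(Dy^*)(Ty)| : y\in S(Y),\ y^*\in S(Y^*)\}$$ over all surjective mappings $T:S(Y)\to S(Z)$ and $D:S(Y^*)\to S(Z^*)$ (not assumed to be continuous or linear); if at least one of such mappings $T$, $D$ does not exist, put $k(Y,Z)=2$. Then $$k(Y,Z)\le 20\,d_\Omega(Y,Z).$$ -/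

import Mathlib

open scoped ENNReal

universe u v

/-- The unit sphere `S(W)` of a subspace `W` of a normed space `X`, as a subset of `X`. -/
def subspaceSphere {𝕜 X : Type*} [RCLike 𝕜] [NormedAddCommGroup X] [NormedSpace 𝕜 X]
    (W : Submodule 𝕜 X) : Set X :=
  {x : X | x ∈ W ∧ ‖x‖ = 1}

/-- The one-sided spherical opening `Ω₀(V, W) = sup {dist(v, S(W)) : v ∈ S(V)}`, with values in
`[0, ∞]`; the distance to the empty set is `∞` and the supremum of the empty set is `0`. -/
noncomputable def sphericalOpeningAux {𝕜 X : Type*} [RCLike 𝕜] [NormedAddCommGroup X]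
    [NormedSpace 𝕜 X] (V W : Submodule 𝕜 X) : ℝ≥0∞ :=
  ⨆ v ∈ subspaceSphere V, Metric.infEDist v (subspaceSphere W)

/-- The spherical opening `Ω(V, W) = max {Ω₀(V, W), Ω₀(W, V)}`. -/
noncomputable def sphericalOpening {𝕜 X : Type*} [RCLike 𝕜] [NormedAddCommGroup X]
    [NormedSpace 𝕜 X] (V W : Submodule 𝕜 X) : ℝ≥0∞ :=
  max (sphericalOpeningAux V W) (sphericalOpeningAux W V)

/-- Kadets' distance `d_Ω(Y, Z)`: the infimum of `Ω(U Y, V Z)` over all Banach spaces `X` and all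
linear isometric embeddings `U : Y → X` and `V : Z → X`. Replacing `X` by the closed linear span of
the two images does not change `Ω(U Y, V Z)`, so it is enough to let `X` range over the
universe `max u v`. -/
noncomputable def kadetsDistance (𝕜 : Type*) [RCLike 𝕜]
    (Y : Type u) [NormedAddCommGroup Y] [NormedSpace 𝕜 Y]
    (Z : Type v) [NormedAddCommGroup Z] [NormedSpace 𝕜 Z] : ℝ≥0∞ :=
  ⨅ (X : Type (max u v)) (_ : NormedAddCommGroup X) (_ : NormedSpace 𝕜 X) (_ : CompleteSpace X)
    (U : Y →ₗᵢ[𝕜] X) (V : Z →ₗᵢ[𝕜] X),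
    sphericalOpening (LinearMap.range U.toLinearMap) (LinearMap.range V.toLinearMap)

/-- The quantity `sup {|y*(y) - (D y*)(T y)| : y ∈ S(Y), y* ∈ S(Y*)}` attached to mappings
`T : S(Y) → S(Z)` and `D : S(Y*) → S(Z*)`. -/
noncomputable def sphereMapsDefect {𝕜 Y Z : Type*} [RCLike 𝕜]
    [NormedAddCommGroup Y] [NormedSpace 𝕜 Y] [NormedAddCommGroup Z] [NormedSpace 𝕜 Z]
    (T : Metric.sphere (0 : Y) 1 → Metric.sphere (0 : Z) 1)
    (D : Metric.sphere (0 : StrongDual 𝕜 Y) 1 → Metric.sphere (0 : StrongDual 𝕜 Z) 1) : ℝ≥0∞ :=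
  ⨆ (y : Metric.sphere (0 : Y) 1) (f : Metric.sphere (0 : StrongDual 𝕜 Y) 1),
    ‖(f : StrongDual 𝕜 Y) (y : Y) - (D f : StrongDual 𝕜 Z) (T y : Z)‖ₑ

open scoped Classical in
/-- The quantity `k(Y, Z)`: the infimum of `sphereMapsDefect T D` over all surjections
`T : S(Y) → S(Z)` and `D : S(Y*) → S(Z*)`; it is `2` if there is no such `T` or no such `D`. -/
noncomputable def kQuantity (𝕜 : Type*) [RCLike 𝕜]
    (Y : Type*) [NormedAddCommGroup Y] [NormedSpace 𝕜 Y]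
    (Z : Type*) [NormedAddCommGroup Z] [NormedSpace 𝕜 Z] : ℝ≥0∞ :=
  if (∃ T : Metric.sphere (0 : Y) 1 → Metric.sphere (0 : Z) 1, Function.Surjective T) ∧
      (∃ D : Metric.sphere (0 : StrongDual 𝕜 Y) 1 → Metric.sphere (0 : StrongDual 𝕜 Z) 1,
        Function.Surjective D) then
    ⨅ (T : Metric.sphere (0 : Y) 1 → Metric.sphere (0 : Z) 1)
      (D : Metric.sphere (0 : StrongDual 𝕜 Y) 1 → Metric.sphere (0 : StrongDual 𝕜 Z) 1)
      (_ : Function.Surjective T) (_ : Function.Surjective D), sphereMapsDefect T D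
  else 2

/-! Since `k ≤ 2` always, only embeddings with spherical opening below some `d < 1/10` matter. Being
`d`-close in `X` relates the unit spheres of `Y` and `Z` with additive distortion `2 * d`. For
functionals, extending by Hahn–Banach, restricting and normalizing (`exists_dualClose`) relates the
dual spheres with distortion `4 * d`.

A mere selection from such a relation need not be onto. In `exists_surjective_near` this is repaired
by mapping small disjoint balls around partners of a separated net onto whole balls around the net
points, which only requires enough points in the small balls. The cardinality is supplied by
`nonempty_embedding_of_sphere_relation`: a net `N` of `S(F)` is carried to a separated set in
`S(E)`, so `N^ℕ` injects into `E` by geometric series, while `F` injects into `(ℝ × N)^ℕ` by greedy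
expansion. In dimension at least two, `E` in turn injects into every ball of its sphere. The
resulting maps cost `6 * d` and `8 * d`, which together stay below `20 * d`. -/

/-! ### Surjections that follow a relation -/

/-- Every metric space contains a `δ`-separated `δ`-net. -/
theorem exists_separated_net (B : Type*) [MetricSpace B] {δ : ℝ} (hδ : 0 ≤ δ) :
    ∃ N : Set B, N.Pairwise (fun x y => δ < dist x y) ∧ ∀ b, ∃ n ∈ N, dist b n ≤ δ := by
  obtain ⟨N, hN⟩ := zorn_subset {N : Set B | N.Pairwise (fun x y => δ < dist x y)}
    (fun c hc hchain => ⟨⋃₀ c, by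
      simp only [Set.mem_ofPred_eq]
      exact (Set.pairwise_sUnion hchain.directedOn).2 fun s hs => hc hs,
      fun s hs => Set.subset_sUnion_of_mem hs⟩)
  refine ⟨N, hN.prop, fun b => ?_⟩
  by_contra! h
  have hins : (insert b N).Pairwise (fun x y => δ < dist x y) := by
    refine hN.prop.insert fun n hn _ => ⟨h n hn, ?_⟩
    rw [dist_comm]
    exact h n hn
  have hb : b ∈ N := hN.le_of_ge hins (Set.subset_insert b N) (Set.mem_insert b N)
  have := h b hb
  rw [dist_self] at this
  linarith

/-- Two metric spaces that are matched by a relation which distorts distances by at most `κ` admit a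
surjection that nearly follows the relation, provided that balls in the source are at least
as numerous as the corresponding balls in the target. -/
theorem exists_surjective_near {A B : Type*} [MetricSpace A] [MetricSpace B] (R : A → B → Prop)
    {κ r δ : ℝ} (hr : 0 < r) (hδ : 0 ≤ δ) (hκ : κ + 2 * r ≤ δ)
    (hl : ∀ a, ∃ b, R a b) (hrt : ∀ b, ∃ a, R a b)
    (hR : ∀ a a' b b', R a b → R a' b' → dist b b' ≤ dist a a' + κ)
    (hcard : ∀ a b, R a b →
      ∃ s : Metric.ball a r → Metric.closedBall b δ, Function.Surjective s) :
    ∃ T : A → B, Function.Surjective T ∧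
      ∀ a, ∃ a' b', R a' b' ∧ dist a a' < r ∧ dist (T a) b' ≤ δ := by
  classical
  obtain ⟨N, hsep, hnet⟩ := exists_separated_net B hδ
  choose p hp using hl
  choose q hq using hrt
  choose s hs using fun b => hcard (q b) b (hq b)
  -- The centres `q n`, `n ∈ N`, are more than `δ - κ ≥ 2 * r` apart, so these balls are disjoint
  -- and the choice of `n` is forced.
  let T : A → B := fun a =>
    if h : ∃ n ∈ N, a ∈ Metric.ball (q n) r then s h.choose ⟨a, h.choose_spec.2⟩ else p a
  refine ⟨T, fun b => ?_, fun a => ?_⟩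
  · obtain ⟨n, hn, hbn⟩ := hnet b
    obtain ⟨⟨a, ha⟩, hab⟩ := hs n ⟨b, hbn⟩
    refine ⟨a, ?_⟩
    have h : ∃ n ∈ N, a ∈ Metric.ball (q n) r := ⟨n, hn, ha⟩
    have hn' : h.choose = n := by
      by_contra hne
      have h1 := hsep h.choose_spec.1 hn hne
      have h2 := hR _ _ _ _ (hq h.choose) (hq n)
      have h3 := h.choose_spec.2
      rw [Metric.mem_ball] at h3 ha
      have h4 := dist_triangle_left (q h.choose) (q n) a
      linarith
    have key : ∀ m (hm : a ∈ Metric.ball (q m) r), m = n → (s m ⟨a, hm⟩ : B) = b := by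
      rintro m hm rfl
      rw [hab]
    simp only [T, dif_pos h]
    exact key _ _ hn'
  · by_cases h : ∃ n ∈ N, a ∈ Metric.ball (q n) r
    · refine ⟨q h.choose, h.choose, hq _, h.choose_spec.2, ?_⟩
      simp only [T, dif_pos h]
      exact (s h.choose _).2
    · refine ⟨a, p a, hp a, by simpa using hr, ?_⟩
      simpa only [T, dif_neg h, dist_self] using hδ

/-! ### Cardinality of spaces with matched spheres -/

/-- A Banach space contains all sequences over any uniformly separated bounded family. -/
theorem injective_sequences_of_separated {N E : Type*} [NormedAddCommGroup E] [NormedSpace ℝ E]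
    [CompleteSpace E] (φ : N → E) (hφ : ∀ n, ‖φ n‖ ≤ 1) {s : ℝ} (hs : 0 < s)
    (hsep : ∀ m n, m ≠ n → s ≤ ‖φ m - φ n‖) :
    ∃ Ψ : (ℕ → N) → E, Function.Injective Ψ := by
  obtain ⟨c, hc0, hc1, hc⟩ : ∃ c : ℝ, 0 < c ∧ c < 1 ∧ 2 * (c * (1 - c)⁻¹) < s := by
    refine ⟨s / (4 + s), by positivity, ?_, ?_⟩
    · rw [div_lt_one (by positivity)]; linarith
    · have : 1 - s / (4 + s) = 4 / (4 + s) := by field_simp; ring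
      rw [this]
      field_simp
      linarith
  have hbound : ∀ (u : ℕ → N) k, ‖c ^ k • φ (u k)‖ ≤ c ^ k := fun u k => by
    rw [norm_smul, norm_pow, Real.norm_of_nonneg hc0.le]
    exact mul_le_of_le_one_right (by positivity) (hφ _)
  have hgeo := summable_geometric_of_lt_one hc0.le hc1
  have hsum : ∀ u : ℕ → N, Summable fun k => c ^ k • φ (u k) := fun u =>
    Summable.of_norm_bounded hgeo (hbound u)
  let Ψ : (ℕ → N) → E := fun u => ∑' k, c ^ k • φ (u k)
  have hΨ : ∀ u, ‖Ψ u‖ ≤ (1 - c)⁻¹ := fun u =>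
    tsum_of_norm_bounded (hasSum_geometric_of_lt_one hc0.le hc1) (hbound u)
  have hrec : ∀ u, Ψ u = φ (u 0) + c • Ψ fun k => u (k + 1) := fun u => by
    simp only [Ψ]
    rw [(hsum u).tsum_eq_zero_add, ← tsum_const_smul'']
    simp [pow_succ', mul_smul]
  have hhead : ∀ u v, Ψ u = Ψ v → u 0 = v 0 := fun u v h => by
    by_contra hne
    have h1 := hsep _ _ hne
    rw [hrec u, hrec v] at h
    have h2 : φ (u 0) - φ (v 0) =
        c • ((Ψ fun k => v (k + 1)) - Ψ fun k => u (k + 1)) := by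
      rw [smul_sub, sub_eq_sub_iff_add_eq_add, h, add_comm]
    rw [h2, norm_smul, Real.norm_of_nonneg hc0.le] at h1
    have h3 := norm_sub_le (Ψ fun k => v (k + 1)) (Ψ fun k => u (k + 1))
    have h4 := hΨ fun k => v (k + 1)
    have h5 := hΨ fun k => u (k + 1)
    have h6 := mul_le_mul_of_nonneg_left (h3.trans (add_le_add h4 h5)) hc0.le
    linarith
  refine ⟨Ψ, fun u v h => funext fun n => ?_⟩
  induction n generalizing u v with
  | zero => exact hhead u v h
  | succ n ih =>
    refine ih (u := fun k => u (k + 1)) (v := fun k => v (k + 1)) ?_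
    have h0 := hhead u v h
    rw [hrec u, hrec v, h0] at h
    exact smul_right_injective E hc0.ne' (add_left_cancel h)

/-- Greedy expansion with respect to a net of the unit sphere. -/
theorem injective_greedy_expansion {N F : Type*} [NormedAddCommGroup F] [NormedSpace ℝ F]
    (e : N → F) {ε : ℝ} (hε0 : 0 ≤ ε) (hε1 : ε < 1)
    (hnet : ∀ z, ∃ n, ‖z - ‖z‖ • e n‖ ≤ ε * ‖z‖) :
    ∃ Φ : F → (ℕ → ℝ × N), Function.Injective Φ := by
  choose g hg using hnet
  let step : F → F := fun z => z - ‖z‖ • e (g z)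
  have hstep : ∀ k z, ‖step^[k] z‖ ≤ ε ^ k * ‖z‖ := fun k z => by
    induction k with
    | zero => simp
    | succ k ih =>
      rw [Function.iterate_succ_apply', pow_succ', mul_assoc]
      exact (hg _).trans (mul_le_mul_of_nonneg_left ih hε0)
  refine ⟨fun z k => (‖step^[k] z‖, g (step^[k] z)), fun z w h => ?_⟩
  -- Equal codes subtract equal vectors at each step, so the remainders keep the difference `z - w`
  -- while both tend to `0`.
  have hdiff : ∀ k, step^[k] z - step^[k] w = z - w := fun k => by
    induction k with
    | zero => simp
    | succ k ih =>
      have h1 := congrFun h k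
      simp only [Prod.mk.injEq] at h1
      rw [Function.iterate_succ_apply', Function.iterate_succ_apply']
      simp only [step] at *
      rw [h1.1, h1.2, sub_sub_sub_cancel_right, ih]
  have hlim : Filter.Tendsto (fun k => ε ^ k * (‖z‖ + ‖w‖)) Filter.atTop (nhds 0) := by
    simpa using (tendsto_pow_atTop_nhds_zero_of_lt_one hε0 hε1).mul_const (‖z‖ + ‖w‖)
  have hle : ‖z - w‖ ≤ 0 := ge_of_tendsto' hlim fun k => by
    rw [← hdiff k, mul_add]
    exact (norm_sub_le _ _).trans (add_le_add (hstep k z) (hstep k w))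
  exact sub_eq_zero.1 (norm_le_zero_iff.1 hle)

/-- A space whose unit sphere is matched, up to a distortion `κ < 1`, with the unit sphere of a
Banach space embeds as a set into that Banach space. -/
theorem nonempty_embedding_of_sphere_relation {E F : Type*}
    [NormedAddCommGroup E] [NormedSpace ℝ E] [CompleteSpace E] [Nontrivial E]
    [NormedAddCommGroup F] [NormedSpace ℝ F] [Nontrivial F]
    (R : Metric.sphere (0 : E) 1 → Metric.sphere (0 : F) 1 → Prop) {κ : ℝ} (hκ0 : 0 ≤ κ)
    (hκ : κ < 1) (hrt : ∀ b, ∃ a, R a b)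
    (hR : ∀ a a' b b', R a b → R a' b' → dist b b' ≤ dist a a' + κ) : Nonempty (F ↪ E) := by
  -- `ε > κ` keeps the partners of the net separated by `ε - κ`; `ε < 1` makes the greedy expansion
  -- converge.
  obtain ⟨ε, hε, hε1⟩ := exists_between hκ
  have hε0 : 0 ≤ ε := hκ0.trans hε.le
  obtain ⟨N, hsep, hnet⟩ := exists_separated_net (Metric.sphere (0 : F) 1) hε0
  choose q hq using hrt
  obtain ⟨Ψ, hΨ⟩ := injective_sequences_of_separated (fun n : N => (q n : E))
    (fun n => (norm_eq_of_mem_sphere (q n)).le) (sub_pos.2 hε) (fun m n hmn => by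
      have h1 := hsep m.2 n.2 (Subtype.coe_ne_coe.2 hmn)
      have h2 := hR _ _ _ _ (hq m) (hq n)
      rw [Subtype.dist_eq (q m), dist_eq_norm] at h2
      linarith)
  obtain ⟨Φ, hΦ⟩ := injective_greedy_expansion (fun n : N => ((n : Metric.sphere (0 : F) 1) : F))
    hε0 hε1 (fun z => by
      rcases eq_or_ne z 0 with rfl | hz
      · obtain ⟨x, hx⟩ := (NormedSpace.sphere_nonempty (x := (0 : F)) (r := 1)).2 zero_le_one
        obtain ⟨n, hn, -⟩ := hnet ⟨x, hx⟩
        exact ⟨⟨n, hn⟩, by simp⟩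
      · have hz' : ‖z‖ ≠ 0 := norm_ne_zero_iff.2 hz
        obtain ⟨n, hn, hd⟩ := hnet ⟨‖z‖⁻¹ • z, by simp [norm_smul, hz']⟩
        refine ⟨⟨n, hn⟩, ?_⟩
        rw [Subtype.dist_eq, dist_eq_norm] at hd
        have h1 : z - ‖z‖ • (n : F) = ‖z‖ • (‖z‖⁻¹ • z - (n : F)) := by
          rw [smul_sub, smul_inv_smul₀ hz']
        rw [h1, norm_smul, norm_norm, mul_comm]
        exact mul_le_mul_of_nonneg_right hd (norm_nonneg z))
  have hRR : Nonempty ((ℕ → ℝ) ≃ ℝ) := by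
    rw [← Cardinal.eq]
    simp [Cardinal.mk_real]
  obtain ⟨eR⟩ := hRR
  have : Infinite E := Module.Free.infinite ℝ E
  have hEE : Nonempty (E × E ≃ E) := by
    rw [← Cardinal.eq, Cardinal.mk_prod, Cardinal.lift_id]
    exact Cardinal.mul_eq_self (Cardinal.aleph0_le_mk E)
  obtain ⟨eE⟩ := hEE
  obtain ⟨x, hx⟩ := exists_ne (0 : E)
  let line : ℝ ↪ E := ⟨fun t => t • x, smul_left_injective ℝ hx⟩
  exact ⟨(⟨Φ, hΦ⟩ : F ↪ _).trans <| (Equiv.arrowProdEquivProdArrow ℕ (fun _ => ℝ)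
    (fun _ => N)).toEmbedding.trans <|
    ((eR.toEmbedding.trans line).prodMap ⟨Ψ, hΨ⟩).trans eE.toEmbedding⟩

/-! ### Unit spheres: dimension, small balls, surjections -/

theorem eq_or_eq_neg_of_rank_le_one {E : Type*} [NormedAddCommGroup E] [NormedSpace ℝ E]
    (h : Module.rank ℝ E ≤ 1) (a b : Metric.sphere (0 : E) 1) : a = b ∨ a = -b := by
  obtain ⟨v, hv⟩ := rank_le_one_iff.1 h
  obtain ⟨s, hs⟩ := hv a
  obtain ⟨t, ht⟩ := hv b
  have ha := norm_eq_of_mem_sphere a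
  have hb := norm_eq_of_mem_sphere b
  rw [← hs, norm_smul] at ha
  rw [← ht, norm_smul] at hb
  have hv0 : ‖v‖ ≠ 0 := fun h0 => by simp [h0] at ha
  have hst : |s| = |t| := mul_right_cancel₀ hv0 (ha.trans hb.symm)
  rcases abs_eq_abs.1 hst with rfl | rfl
  · exact Or.inl (Subtype.ext (hs.symm.trans ht))
  · exact Or.inr (Subtype.ext (by rw [← hs, neg_smul, ht]; rfl))

/-- If the unit spheres are matched with distortion `κ < 1`, compatibly with the antipodal map, and
the target has dimension at least two, then so has the source. -/
theorem one_lt_rank_of_sphere_relation {E F : Type*}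
    [NormedAddCommGroup E] [NormedSpace ℝ E] [NormedAddCommGroup F] [NormedSpace ℝ F]
    (R : Metric.sphere (0 : E) 1 → Metric.sphere (0 : F) 1 → Prop) {κ : ℝ}
    (hκ : κ < 1) (hrt : ∀ b, ∃ a, R a b) (hneg : ∀ a b, R a b → R (-a) (-b))
    (hR : ∀ a a' b b', R a b → R a' b' → dist b b' ≤ dist a a' + κ)
    (hF : 1 < Module.rank ℝ F) : 1 < Module.rank ℝ E := by
  by_contra! hE
  have : Nontrivial F := rank_pos_iff_nontrivial.1 (zero_lt_one.trans hF)
  obtain ⟨x, hx⟩ := (NormedSpace.sphere_nonempty (x := (0 : F)) (r := 1)).2 zero_le_one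
  let b₀ : Metric.sphere (0 : F) 1 := ⟨x, hx⟩
  obtain ⟨a₀, h₀⟩ := hrt b₀
  have hanti : dist (-b₀) b₀ = 2 := by
    rw [Subtype.dist_eq, dist_eq_norm]
    change ‖-x - x‖ = 2
    rw [← neg_add', norm_neg, ← two_smul ℝ x, norm_smul, mem_sphere_zero_iff_norm.1 hx]
    norm_num
  have hpre : PreconnectedSpace (Metric.sphere (0 : F) 1) :=
    Subtype.preconnectedSpace (isPreconnected_sphere hF 0 1)
  -- Such a `b` is at distance at least `1` from both `b₀` and `-b₀`, but its partner can only be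
  -- `a₀` or `-a₀`.
  obtain ⟨b, hb⟩ := mem_range_of_exists_le_of_exists_ge
    (f := fun b : Metric.sphere (0 : F) 1 => dist b b₀) (c := 1) (by fun_prop)
    ⟨b₀, by simp⟩ ⟨-b₀, by simp only [hanti]; norm_num⟩
  simp only at hb
  obtain ⟨a, hab⟩ := hrt b
  rcases eq_or_eq_neg_of_rank_le_one hE a a₀ with rfl | rfl
  · have := hR _ _ _ _ hab h₀
    rw [dist_self] at this
    linarith
  · have h1 := hR _ _ _ _ hab (hneg _ _ h₀)
    rw [dist_self] at h1
    have h2 := dist_triangle_left (-b₀) b₀ b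
    linarith

/-- In dimension at least two, every ball of the unit sphere is as numerous as the whole space. -/
theorem nonempty_embedding_sphere_ball {E : Type*} [NormedAddCommGroup E] [NormedSpace ℝ E]
    (hE : 1 < Module.rank ℝ E) (a : Metric.sphere (0 : E) 1) {r : ℝ} (hr : 0 < r) :
    Nonempty (E ↪ Metric.ball a r) := by
  have ha : ‖(a : E)‖ = 1 := norm_eq_of_mem_sphere a
  have ha0 : (a : E) ≠ 0 := norm_ne_zero_iff.1 (by rw [ha]; norm_num)
  obtain ⟨w, hw⟩ := exists_linearIndependent_pair_of_one_lt_rank hE ha0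
  have : Nontrivial E := ⟨a, 0, ha0⟩
  let C : Set E := {x | x ≠ 0 ∧ ‖‖x‖⁻¹ • x - a‖ < r}
  have hC : C ∈ nhds (a : E) := by
    refine (eventually_ne_nhds ha0).and ?_
    have hcont : ContinuousAt (fun x : E => ‖‖x‖⁻¹ • x - a‖) a := by
      refine (((continuousAt_id.norm.inv₀ ?_).smul continuousAt_id).sub continuousAt_const).norm
      exact norm_ne_zero_iff.2 ha0
    refine hcont.eventually_lt continuousAt_const ?_
    simpa [ha] using hr
  let radial : C → Metric.ball a r := fun x =>
    ⟨⟨‖(x : E)‖⁻¹ • (x : E), by simp [norm_smul, x.2.1]⟩, by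
      rw [Metric.mem_ball, Subtype.dist_eq, dist_eq_norm]
      exact x.2.2⟩
  have hradial : ∀ x y, radial x = radial y → ‖(x : E)‖⁻¹ • (x : E) = ‖(y : E)‖⁻¹ • (y : E) :=
    fun x y h => congrArg (fun z : Metric.ball a r => ((z : Metric.sphere (0 : E) 1) : E)) h
  let S : Set ℝ := {s | (a : E) + s • w ∈ C}
  have hS : S ∈ nhds (0 : ℝ) := by
    have hcont : ContinuousAt (fun s : ℝ => (a : E) + s • w) 0 := by fun_prop
    exact hcont.preimage_mem_nhds (by simpa using hC)
  obtain ⟨eS⟩ := Cardinal.eq.1 (cardinal_eq_of_mem_nhds ℝ hS)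
  obtain ⟨eC⟩ := Cardinal.eq.1 (cardinal_eq_of_mem_nhds ℝ hC)
  -- Points of a segment not on a line through `0` have distinct radial projections, so the ball has
  -- at least continuum many points and absorbs the radius in `polar`.
  let arc : S ↪ Metric.ball a r := ⟨fun s => radial ⟨(a : E) + (s : ℝ) • w, s.2⟩, fun s t h => by
    have h1 := hradial _ _ h
    simp only [smul_add, smul_smul] at h1
    obtain ⟨h2, h3⟩ := hw.eq_of_pair h1
    rw [h2] at h3
    have hne : ‖(a : E) + (t : ℝ) • w‖⁻¹ ≠ 0 := inv_ne_zero (norm_ne_zero_iff.2 t.2.1)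
    exact Subtype.ext (mul_left_cancel₀ hne h3)⟩
  let polar : C ↪ ℝ × Metric.ball a r := ⟨fun x => (‖(x : E)‖, radial x), fun x y h => by
    obtain ⟨h1, h2⟩ := Prod.mk.inj h
    have h3 := hradial _ _ h2
    rw [h1] at h3
    exact Subtype.ext (smul_right_injective E (inv_ne_zero (norm_ne_zero_iff.2 y.2.1)) h3)⟩
  have line : ℝ ↪ Metric.ball a r := eS.symm.toEmbedding.trans arc
  have : Infinite (Metric.ball a r) := Infinite.of_injective line line.injective
  have hsq : Nonempty (Metric.ball a r × Metric.ball a r ≃ Metric.ball a r) := by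
    rw [← Cardinal.eq, Cardinal.mk_prod, Cardinal.lift_id]
    exact Cardinal.mul_eq_self (Cardinal.aleph0_le_mk _)
  obtain ⟨esq⟩ := hsq
  exact ⟨eC.symm.toEmbedding.trans <| polar.trans <|
    (line.prodMap (Function.Embedding.refl _)).trans esq.toEmbedding⟩

/-- If the unit spheres of a Banach space and of a normed space are matched, compatibly with the
antipodal map and with distortion at most `κ < 1`, then some surjection between the spheres nearly
follows the matching. -/
theorem exists_surjective_sphere_near {E F : Type*}
    [NormedAddCommGroup E] [NormedSpace ℝ E] [CompleteSpace E]
    [NormedAddCommGroup F] [NormedSpace ℝ F]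
    (R : Metric.sphere (0 : E) 1 → Metric.sphere (0 : F) 1 → Prop) {κ r δ : ℝ}
    (hκ0 : 0 ≤ κ) (hκ1 : κ < 1) (hr : 0 < r) (hκ : κ + 2 * r ≤ δ) (hδ : δ < 2)
    (hl : ∀ a, ∃ b, R a b) (hrt : ∀ b, ∃ a, R a b) (hneg : ∀ a b, R a b → R (-a) (-b))
    (hR : ∀ a a' b b', R a b → R a' b' → dist b b' ≤ dist a a' + κ) :
    ∃ T : Metric.sphere (0 : E) 1 → Metric.sphere (0 : F) 1, Function.Surjective T ∧
      ∀ a, ∃ a' b', R a' b' ∧ dist a a' < r ∧ dist (T a) b' ≤ δ := by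
  have hδ0 : 0 ≤ δ := by linarith
  refine exists_surjective_near R hr hδ0 hκ hl hrt hR fun a b _ => ?_
  have : Nonempty (Metric.closedBall b δ) := ⟨⟨b, Metric.mem_closedBall_self hδ0⟩⟩
  rcases le_or_gt (Module.rank ℝ F) 1 with hF | hF
  -- The target sphere is at most an antipodal pair at distance `2 > δ`, so the closed ball is a
  -- single point.
  · refine ⟨fun _ => ⟨b, Metric.mem_closedBall_self hδ0⟩, fun ⟨c, hc⟩ =>
      ⟨⟨a, Metric.mem_ball_self hr⟩, Subtype.ext ?_⟩⟩
    rcases eq_or_eq_neg_of_rank_le_one hF b c with h | h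
    · exact h
    · exfalso
      rw [Metric.mem_closedBall, Subtype.dist_eq, h, dist_eq_norm] at hc
      have h1 : (c : F) - ((-c : Metric.sphere (0 : F) 1) : F) = (2 : ℝ) • (c : F) := by
        rw [two_smul]
        exact sub_neg_eq_add _ _
      rw [h1, norm_smul, norm_eq_of_mem_sphere] at hc
      norm_num at hc
      linarith
  · have hE := one_lt_rank_of_sphere_relation R hκ1 hrt hneg hR hF
    have : Nontrivial F := rank_pos_iff_nontrivial.1 (zero_lt_one.trans hF)
    have : Nontrivial E := rank_pos_iff_nontrivial.1 (zero_lt_one.trans hE)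
    obtain ⟨i⟩ := nonempty_embedding_of_sphere_relation R hκ0 hκ1 hrt hR
    obtain ⟨j⟩ := nonempty_embedding_sphere_ball hE a hr
    let k : Metric.closedBall b δ ↪ Metric.ball a r :=
      ((Function.Embedding.subtype _).trans (Function.Embedding.subtype _)).trans (i.trans j)
    exact ⟨Function.invFun k, Function.invFun_surjective k.injective⟩

/-! ### Functionals on nearby subspaces -/

section Duality

variable {𝕜 X Y Z : Type*} [RCLike 𝕜] [NormedAddCommGroup X] [NormedSpace 𝕜 X]
  [NormedAddCommGroup Y] [NormedSpace 𝕜 Y] [NormedAddCommGroup Z] [NormedSpace 𝕜 Z]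

/-- Functionals on two subspaces of a common space are `d`-close if their values at unit vectors
differ by at most `d` more than the vectors do. -/
def DualClose (U : Y →ₗᵢ[𝕜] X) (V : Z →ₗᵢ[𝕜] X) (d : ℝ) (f : StrongDual 𝕜 Y)
    (g : StrongDual 𝕜 Z) : Prop :=
  ∀ y z, ‖y‖ = 1 → ‖z‖ = 1 → ‖f y - g z‖ ≤ d + ‖U y - V z‖

variable {U : Y →ₗᵢ[𝕜] X} {V : Z →ₗᵢ[𝕜] X} {d : ℝ}

theorem DualClose.symm {f : StrongDual 𝕜 Y} {g : StrongDual 𝕜 Z} (h : DualClose U V d f g) :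
    DualClose V U d g f := fun z y hz hy => by
  rw [norm_sub_rev, norm_sub_rev (V z)]
  exact h y z hy hz

theorem DualClose.neg {f : StrongDual 𝕜 Y} {g : StrongDual 𝕜 Z} (h : DualClose U V d f g) :
    DualClose U V d (-f) (-g) := fun y z hy hz => by
  rw [neg_apply, neg_apply, neg_sub_neg, norm_sub_rev]
  exact h y z hy hz

/-- Functionals of norm one on a subspace have close counterparts of norm one on a nearby
subspace. -/
theorem exists_dualClose (hd : d < 1)
    (hUV : ∀ y, ‖y‖ = 1 → ∃ z, ‖z‖ = 1 ∧ ‖U y - V z‖ ≤ d) (hd0 : 0 ≤ d)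
    (f : StrongDual 𝕜 Y) (hf : ‖f‖ = 1) :
    ∃ g : StrongDual 𝕜 Z, ‖g‖ = 1 ∧ DualClose U V d f g := by
  obtain ⟨F, hF, hFn⟩ := exists_extension_norm_eq (LinearMap.range U.toLinearMap)
    (f.comp (U.equivRange.symm.toContinuousLinearEquiv : _ →L[𝕜] Y))
  have hFU : ∀ y, F (U y) = f y := fun y => by
    have := hF (U.equivRange y)
    simpa using this
  have hF1 : ‖F‖ ≤ 1 := by
    rw [hFn]
    refine ContinuousLinearMap.opNorm_le_bound _ zero_le_one fun x => ?_
    have := f.le_opNorm (U.equivRange.symm x)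
    rw [hf, LinearIsometryEquiv.norm_map] at this
    exact this
  have hFle : ∀ x, ‖F x‖ ≤ ‖x‖ := fun x => by
    simpa using F.le_of_opNorm_le hF1 x
  let G : StrongDual 𝕜 Z := F.comp V.toContinuousLinearMap
  have hG1 : ‖G‖ ≤ 1 := ContinuousLinearMap.opNorm_le_bound _ zero_le_one fun z => by
    simpa [G] using hFle (V z)
  -- The restriction loses at most `d` of the norm, so normalizing it moves it by `1 - ‖G‖ ≤ d`.
  have hGd : 1 ≤ d + ‖G‖ := by
    rw [← hf]
    refine ContinuousLinearMap.opNorm_le_of_unit_norm (add_nonneg hd0 (norm_nonneg G))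
      fun y hy => ?_
    obtain ⟨z, hz, hyz⟩ := hUV y hy
    have h1 : f y = F (U y - V z) + G z := by simp [G, hFU]
    have h2 := G.le_opNorm z
    rw [hz, mul_one] at h2
    rw [h1]
    exact (norm_add_le _ _).trans (add_le_add ((hFle _).trans hyz) h2)
  have hG0 : 0 < ‖G‖ := by linarith
  have hGinv : ‖((‖G‖⁻¹ : ℝ) : 𝕜) • G‖ = 1 := by
    rw [norm_smul, RCLike.norm_ofReal, abs_of_pos (inv_pos.2 hG0), inv_mul_cancel₀ hG0.ne']
  refine ⟨((‖G‖⁻¹ : ℝ) : 𝕜) • G, hGinv, fun y z hy hz => ?_⟩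
  have hdiff : ‖G - ((‖G‖⁻¹ : ℝ) : 𝕜) • G‖ ≤ d := by
    have h1 : G - ((‖G‖⁻¹ : ℝ) : 𝕜) • G = ((1 - ‖G‖⁻¹ : ℝ) : 𝕜) • G := by
      ext x
      simp only [sub_apply, smul_apply, smul_eq_mul]
      push_cast
      ring
    have h2 : 1 ≤ ‖G‖⁻¹ := (one_le_inv₀ hG0).2 hG1
    rw [h1, norm_smul, RCLike.norm_ofReal, abs_of_nonpos (by linarith), neg_sub, sub_mul,
      inv_mul_cancel₀ hG0.ne']
    linarith
  have h3 := (G - ((‖G‖⁻¹ : ℝ) : 𝕜) • G).le_of_opNorm_le hdiff z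
  rw [hz, mul_one] at h3
  have h4 : f y - (((‖G‖⁻¹ : ℝ) : 𝕜) • G) z =
      (G - ((‖G‖⁻¹ : ℝ) : 𝕜) • G) z + F (U y - V z) := by
    rw [sub_apply, map_sub, hFU]
    simp only [G, ContinuousLinearMap.comp_apply, LinearIsometry.coe_toContinuousLinearMap]
    ring
  rw [h4]
  exact (norm_add_le _ _).trans (add_le_add h3 (hFle _))

/-- Testing at a unit `y` within `d` of `z`, each pair contributes `d` from closeness and `d` from
`‖U y - V z‖`. -/
theorem DualClose.norm_sub_le (hd0 : 0 ≤ d)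
    (hVU : ∀ z, ‖z‖ = 1 → ∃ y, ‖y‖ = 1 ∧ ‖U y - V z‖ ≤ d) {f f' : StrongDual 𝕜 Y}
    {g g' : StrongDual 𝕜 Z} (h : DualClose U V d f g) (h' : DualClose U V d f' g') :
    ‖g - g'‖ ≤ ‖f - f'‖ + 4 * d := by
  refine ContinuousLinearMap.opNorm_le_of_unit_norm
    (add_nonneg (norm_nonneg _) (by linarith)) fun z hz => ?_
  obtain ⟨y, hy, hyz⟩ := hVU z hz
  have h1 := h y z hy hz
  have h2 := h' y z hy hz
  have h3 := (f - f').le_opNorm y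
  rw [hy, mul_one] at h3
  have h4 : (g - g') z = (f - f') y - (f y - g z) + (f' y - g' z) := by
    simp only [sub_apply]
    ring
  rw [h4]
  have h5 := norm_add_le ((f - f') y - (f y - g z)) (f' y - g' z)
  have h6 := _root_.norm_sub_le ((f - f') y) (f y - g z)
  linarith

end Duality

/-! ### The surjections of spheres and dual spheres -/

section Spheres

variable {𝕜 : Type*} [RCLike 𝕜] {X Y Z : Type*}
  [NormedAddCommGroup X] [NormedSpace 𝕜 X]
  [NormedAddCommGroup Y] [NormedSpace 𝕜 Y] [NormedAddCommGroup Z] [NormedSpace 𝕜 Z]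
  {U : Y →ₗᵢ[𝕜] X} {V : Z →ₗᵢ[𝕜] X} {d : ℝ}

/-- The total is `r + d + δ` with `r = d` and `δ = 2 * d + 2 * r = 4 * d`. -/
theorem exists_surjective_sphere_norm_sub_le [CompleteSpace Y] (hd0 : 0 < d) (hd : d < 1 / 10)
    (hUV : ∀ y, ‖y‖ = 1 → ∃ z, ‖z‖ = 1 ∧ ‖U y - V z‖ ≤ d)
    (hVU : ∀ z, ‖z‖ = 1 → ∃ y, ‖y‖ = 1 ∧ ‖U y - V z‖ ≤ d) :
    ∃ T : Metric.sphere (0 : Y) 1 → Metric.sphere (0 : Z) 1, Function.Surjective T ∧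
      ∀ y : Metric.sphere (0 : Y) 1, ‖U y - V (T y)‖ ≤ 6 * d := by
  let _ : NormedSpace ℝ Y := NormedSpace.restrictScalars ℝ 𝕜 Y
  let _ : NormedSpace ℝ Z := NormedSpace.restrictScalars ℝ 𝕜 Z
  obtain ⟨T, hT, h⟩ := exists_surjective_sphere_near
    (fun (y : Metric.sphere (0 : Y) 1) (z : Metric.sphere (0 : Z) 1) => ‖U y - V z‖ ≤ d)
    (κ := 2 * d) (r := d) (δ := 4 * d) (by linarith) (by linarith) hd0 (by linarith) (by linarith)
    (fun y => by
      obtain ⟨z, hz, hyz⟩ := hUV y (norm_eq_of_mem_sphere y)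
      exact ⟨⟨z, mem_sphere_zero_iff_norm.2 hz⟩, hyz⟩)
    (fun z => by
      obtain ⟨y, hy, hyz⟩ := hVU z (norm_eq_of_mem_sphere z)
      exact ⟨⟨y, mem_sphere_zero_iff_norm.2 hy⟩, hyz⟩)
    (fun y z hyz => by
      change ‖U (-(y : Y)) - V (-(z : Z))‖ ≤ d
      rwa [map_neg, map_neg, neg_sub_neg, norm_sub_rev])
    (fun y y' z z' hyz hyz' => by
      rw [Subtype.dist_eq, Subtype.dist_eq, ← V.dist_map, ← U.dist_map]
      rw [← dist_eq_norm] at hyz hyz'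
      have h1 := dist_triangle4 (V z) (U y) (U y') (V z')
      rw [dist_comm (V z) (U y)] at h1
      linarith)
  refine ⟨T, hT, fun y => ?_⟩
  obtain ⟨y', z', h1, h2, h3⟩ := h y
  rw [Subtype.dist_eq] at h2 h3
  rw [← U.dist_map] at h2
  rw [← V.dist_map, dist_comm] at h3
  rw [← dist_eq_norm] at h1 ⊢
  have h4 := dist_triangle4 (U y) (U y') (V z') (V (T y))
  linarith

/-- The distortion `4 * d` gives `δ = 6 * d`, and the total is again `r + d + δ`. -/
theorem exists_surjective_dual_sphere (hd0 : 0 < d) (hd : d < 1 / 10)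
    (hUV : ∀ y, ‖y‖ = 1 → ∃ z, ‖z‖ = 1 ∧ ‖U y - V z‖ ≤ d)
    (hVU : ∀ z, ‖z‖ = 1 → ∃ y, ‖y‖ = 1 ∧ ‖U y - V z‖ ≤ d) :
    ∃ D : Metric.sphere (0 : StrongDual 𝕜 Y) 1 → Metric.sphere (0 : StrongDual 𝕜 Z) 1,
      Function.Surjective D ∧ ∀ f : Metric.sphere (0 : StrongDual 𝕜 Y) 1,
        DualClose U V (8 * d) (f : StrongDual 𝕜 Y) (D f) := by
  let _ : NormedSpace ℝ (StrongDual 𝕜 Y) := NormedSpace.restrictScalars ℝ 𝕜 _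
  let _ : NormedSpace ℝ (StrongDual 𝕜 Z) := NormedSpace.restrictScalars ℝ 𝕜 _
  obtain ⟨D, hD, h⟩ := exists_surjective_sphere_near
    (fun (f : Metric.sphere (0 : StrongDual 𝕜 Y) 1) (g : Metric.sphere (0 : StrongDual 𝕜 Z) 1) =>
      DualClose U V d (f : StrongDual 𝕜 Y) g)
    (κ := 4 * d) (r := d) (δ := 6 * d) (by linarith) (by linarith) hd0 (by linarith) (by linarith)
    (fun f => by
      obtain ⟨g, hg, hfg⟩ := exists_dualClose (by linarith) hUV hd0.le f (norm_eq_of_mem_sphere f)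
      exact ⟨⟨g, mem_sphere_zero_iff_norm.2 hg⟩, hfg⟩)
    (fun g => by
      obtain ⟨f, hf, hfg⟩ := exists_dualClose (U := V) (V := U) (by linarith)
        (by simpa only [norm_sub_rev] using hVU) hd0.le g (norm_eq_of_mem_sphere g)
      exact ⟨⟨f, mem_sphere_zero_iff_norm.2 hf⟩, hfg.symm⟩)
    (fun f g hfg => hfg.neg)
    (fun f f' g g' hfg hfg' => by
      rw [Subtype.dist_eq, Subtype.dist_eq, dist_eq_norm, dist_eq_norm]
      exact hfg.norm_sub_le hd0.le hVU hfg')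
  refine ⟨D, hD, fun f y z hy hz => ?_⟩
  obtain ⟨f', g', h1, h2, h3⟩ := h f
  rw [Subtype.dist_eq, dist_eq_norm] at h2 h3
  have h4 := ((f : StrongDual 𝕜 Y) - f').le_of_opNorm_le h2.le y
  have h5 := ((D f : StrongDual 𝕜 Z) - g').le_of_opNorm_le h3 z
  rw [hy, mul_one] at h4
  rw [hz, mul_one] at h5
  have h6 := h1 y z hy hz
  have h7 : (f : StrongDual 𝕜 Y) y - (D f : StrongDual 𝕜 Z) z =
      ((f : StrongDual 𝕜 Y) - f') y - ((D f : StrongDual 𝕜 Z) - g') z +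
        ((f' : StrongDual 𝕜 Y) y - (g' : StrongDual 𝕜 Z) z) := by
    simp only [sub_apply]
    ring
  rw [h7]
  have h8 := norm_add_le (((f : StrongDual 𝕜 Y) - f') y - ((D f : StrongDual 𝕜 Z) - g') z)
    ((f' : StrongDual 𝕜 Y) y - (g' : StrongDual 𝕜 Z) z)
  have h9 := norm_sub_le (((f : StrongDual 𝕜 Y) - f') y) (((D f : StrongDual 𝕜 Z) - g') z)
  linarith

theorem exists_norm_sub_le_of_sphericalOpeningAux_lt (hd0 : 0 ≤ d)
    (h : sphericalOpeningAux (LinearMap.range U.toLinearMap) (LinearMap.range V.toLinearMap) <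
      ENNReal.ofReal d) (y : Y) (hy : ‖y‖ = 1) : ∃ z, ‖z‖ = 1 ∧ ‖U y - V z‖ ≤ d := by
  have hmem : U y ∈ subspaceSphere (LinearMap.range U.toLinearMap) :=
    ⟨⟨y, rfl⟩, by rw [U.norm_map, hy]⟩
  have hlt := (le_iSup₂ (f := fun v (_ : v ∈ subspaceSphere (LinearMap.range U.toLinearMap)) =>
    Metric.infEDist v (subspaceSphere (LinearMap.range V.toLinearMap))) (U y) hmem).trans_lt h
  obtain ⟨_, ⟨⟨z, rfl⟩, hz⟩, hyz⟩ := Metric.infEDist_lt_iff.1 hlt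
  refine ⟨z, (V.norm_map z).symm.trans hz, ?_⟩
  rw [← dist_eq_norm]
  exact (edist_le_ofReal hd0).1 hyz.le

end Spheres

/-! ### The estimate for `k` -/

theorem sphereMapsDefect_le_two {𝕜 Y Z : Type*} [RCLike 𝕜]
    [NormedAddCommGroup Y] [NormedSpace 𝕜 Y] [NormedAddCommGroup Z] [NormedSpace 𝕜 Z]
    (T : Metric.sphere (0 : Y) 1 → Metric.sphere (0 : Z) 1)
    (D : Metric.sphere (0 : StrongDual 𝕜 Y) 1 → Metric.sphere (0 : StrongDual 𝕜 Z) 1) :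
    sphereMapsDefect T D ≤ 2 := by
  refine iSup₂_le fun y f => ?_
  have h1 := (f : StrongDual 𝕜 Y).le_opNorm y
  have h2 := (D f : StrongDual 𝕜 Z).le_opNorm (T y)
  rw [norm_eq_of_mem_sphere, norm_eq_of_mem_sphere, mul_one] at h1 h2
  rw [← ofReal_norm, ← ENNReal.ofReal_ofNat]
  refine ENNReal.ofReal_le_ofReal ((norm_sub_le _ _).trans ?_)
  linarith

theorem kQuantity_le_sphereMapsDefect {𝕜 Y Z : Type*} [RCLike 𝕜]
    [NormedAddCommGroup Y] [NormedSpace 𝕜 Y] [NormedAddCommGroup Z] [NormedSpace 𝕜 Z]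
    {T : Metric.sphere (0 : Y) 1 → Metric.sphere (0 : Z) 1}
    {D : Metric.sphere (0 : StrongDual 𝕜 Y) 1 → Metric.sphere (0 : StrongDual 𝕜 Z) 1}
    (hT : Function.Surjective T) (hD : Function.Surjective D) :
    kQuantity 𝕜 Y Z ≤ sphereMapsDefect T D := by
  rw [kQuantity, if_pos ⟨⟨T, hT⟩, ⟨D, hD⟩⟩]
  exact iInf₂_le_of_le T D (iInf₂_le hT hD)

theorem kQuantity_le_two (𝕜 Y Z : Type*) [RCLike 𝕜]
    [NormedAddCommGroup Y] [NormedSpace 𝕜 Y] [NormedAddCommGroup Z] [NormedSpace 𝕜 Z] :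
    kQuantity 𝕜 Y Z ≤ 2 := by
  by_cases h : (∃ T : Metric.sphere (0 : Y) 1 → Metric.sphere (0 : Z) 1, Function.Surjective T) ∧
      (∃ D : Metric.sphere (0 : StrongDual 𝕜 Y) 1 → Metric.sphere (0 : StrongDual 𝕜 Z) 1,
        Function.Surjective D)
  · obtain ⟨⟨T, hT⟩, ⟨D, hD⟩⟩ := h
    exact (kQuantity_le_sphereMapsDefect hT hD).trans (sphereMapsDefect_le_two T D)
  · rw [kQuantity, if_neg h]

theorem kQuantity_le_sphericalOpening {𝕜 X Y Z : Type*} [RCLike 𝕜]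
    [NormedAddCommGroup X] [NormedSpace 𝕜 X] [NormedAddCommGroup Y] [NormedSpace 𝕜 Y]
    [CompleteSpace Y] [NormedAddCommGroup Z] [NormedSpace 𝕜 Z]
    (U : Y →ₗᵢ[𝕜] X) (V : Z →ₗᵢ[𝕜] X) :
    kQuantity 𝕜 Y Z ≤
      20 * sphericalOpening (LinearMap.range U.toLinearMap) (LinearMap.range V.toLinearMap) := by
  by_contra! hlt
  obtain ⟨c, hc, hck⟩ := exists_between hlt
  have hc2 : c < 2 := hck.trans_le (kQuantity_le_two 𝕜 Y Z)
  have hctop : c ≠ ⊤ := (hc2.trans ENNReal.ofNat_lt_top).ne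
  have hc0 : 0 < c.toReal := ENNReal.toReal_pos (bot_le.trans_lt hc).ne' hctop
  have hc2' : c.toReal < 2 := by
    simpa using (ENNReal.toReal_lt_toReal hctop ENNReal.ofNat_ne_top).2 hc2
  -- The bound `c < 2` is exactly `d < 1 / 10`, which keeps distortions below `1` and `δ` below `2`.
  obtain ⟨d, hdc⟩ : ∃ d : ℝ, c.toReal = 20 * d := ⟨c.toReal / 20, by ring⟩
  have hd0 : 0 < d := by linarith
  have hd : d < 1 / 10 := by linarith
  have hcd : c = 20 * ENNReal.ofReal d := by
    rw [← ENNReal.ofReal_toReal hctop, hdc, ENNReal.ofReal_mul (by norm_num),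
      ENNReal.ofReal_ofNat]
  rw [hcd, ENNReal.mul_lt_mul_iff_right (by norm_num) ENNReal.ofNat_ne_top, sphericalOpening,
    max_lt_iff] at hc
  have hUV := exists_norm_sub_le_of_sphericalOpeningAux_lt hd0.le hc.1
  have hVU : ∀ z, ‖z‖ = 1 → ∃ y, ‖y‖ = 1 ∧ ‖U y - V z‖ ≤ d := by
    simpa only [norm_sub_rev] using exists_norm_sub_le_of_sphericalOpeningAux_lt hd0.le hc.2
  obtain ⟨T, hT, hTd⟩ := exists_surjective_sphere_norm_sub_le hd0 hd hUV hVU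
  obtain ⟨D, hD, hDd⟩ := exists_surjective_dual_sphere hd0 hd hUV hVU
  refine hck.not_ge ((kQuantity_le_sphereMapsDefect hT hD).trans (iSup₂_le fun y f => ?_))
  rw [← ofReal_norm, ← ENNReal.ofReal_toReal hctop]
  refine ENNReal.ofReal_le_ofReal ?_
  have h1 := hDd f y (T y) (norm_eq_of_mem_sphere y) (norm_eq_of_mem_sphere (T y))
  have h2 := hTd y
  -- The defect is at most `8 * d + 6 * d = 14 * d`, below `20 * d`.
  linarith

theorem proposition1 {𝕜 : Type*} [RCLike 𝕜]
    (Y : Type u) [NormedAddCommGroup Y] [NormedSpace 𝕜 Y] [CompleteSpace Y]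
    (Z : Type v) [NormedAddCommGroup Z] [NormedSpace 𝕜 Z] [CompleteSpace Z] :
    kQuantity 𝕜 Y Z ≤ 20 * kadetsDistance 𝕜 Y Z := by
  simp only [kadetsDistance, ENNReal.mul_iInf_of_ne (show (20 : ℝ≥0∞) ≠ 0 by norm_num)
    ENNReal.ofNat_ne_top]
  exact le_iInf fun X => le_iInf fun _ => le_iInf fun _ => le_iInf fun _ => le_iInf fun U =>
    le_iInf fun V => kQuantity_le_sphericalOpening U V
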